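/- Let $D(k,t)$ denote the distance graph with vertex set $\mathbb{Z}$ in which two distinct integers $i,j$ are adjacent if and only if $|i-j|\in\{k,t\}$. For a graph $G$, let $\chi_\rho(G)$ denote its packing chromatic number, i.e. the smallest integer $p$ for which the vertices of $G$ can be colored with the colors $1,\dots,p$ in such a way that any two distinct vertices of the same color $i$ are at distance greater than $i$ in $G$. Let $k,t$ be positive integers such that $k$ is odd, $t\ge 898$ is even, and $k,t$ are coprime (i.e. $D(k,t)$ is connected). Then $$\chi_\rho(D(k,t))\le 56.$$ -/

import Mathlib

/-- The distance graph on the integers with distance set `D`: two distinct integers are adjacent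
if and only if the absolute value of their difference belongs to `D`. -/
def distanceGraph (D : Set ℕ) : SimpleGraph ℤ where
  Adj i j := i ≠ j ∧ (i - j).natAbs ∈ D
  symm := ⟨fun i j h => ⟨h.1.symm, by rw [← Int.natAbs_neg, neg_sub]; exact h.2⟩⟩
  loopless := ⟨fun _ h => h.1 rfl⟩

/-- A packing `p`-coloring of `G`: the vertices are colored with the colors `1, …, p` (some of which
may be unused) so that any two distinct vertices of the same color `i` have distance greater than
`i`. Vertices in different components have distance `⊤`. -/
def IsPackingColoring {V : Type*} (G : SimpleGraph V) (p : ℕ) (c : V → ℕ) : Prop :=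
  (∀ v, 1 ≤ c v ∧ c v ≤ p) ∧
    ∀ u v, u ≠ v → c u = c v → (c u : ℕ∞) < G.edist u v

/-- The packing chromatic number of `G`: the smallest `p` for which `G` has a packing `p`-coloring,
and `⊤` if there is no such `p`. -/
noncomputable def packingChromaticNumber {V : Type*} (G : SimpleGraph V) : ℕ∞ :=
  ⨅ p ∈ {p : ℕ | ∃ c : V → ℕ, IsPackingColoring G p c}, (p : ℕ∞)

/-! ### Distance graphs with two distances as quotients of the square lattice -/

/-! Since `k` and `t` are coprime, `D(k, t)` is the square lattice modulo translation by `(t, -k)`: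
the point `(x, y)` represents `x * k + y * t`. So it suffices to color the strip `0 ≤ x < t`
compatibly with gluing its two sides at height offset `k`.

Color 1 takes the points of even coordinate sum. On the remaining points, rotated by 45 degrees, a
doubly periodic pattern uses the colors 2 to 18. The gluing disturbs this twice. As `t - k` is odd,
it swaps the parity classes; column `0`, filled with colors above 18, separates them. It also need
not respect the periods of the pattern. This is repaired by seams: columns whose odd points get
colors above 18, and past which the pattern is delayed one column and moved one row up or down. In
rotated coordinates `(u, v)` an upward seam is a unit step in `u`, a downward one a unit step in
`v`, and 28 seams reach every class modulo the periods (`exists_steps`). Undoing seams never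
increases the `ℓ¹` distance, so the pattern stays a packing (`stripColor_sep_inside`,
`stripColor_sep_across`). -/

lemma exists_combination_of_walk {k t : ℕ} {n m : ℤ} (w : (distanceGraph {k, t}).Walk n m) :
    ∃ a b : ℤ, m - n = a * k + b * t ∧ a.natAbs + b.natAbs ≤ w.length := by
  induction w with
  | nil => exact ⟨0, 0, by simp, by simp⟩
  | @cons u v w h p ih =>
    obtain ⟨a, b, hab, hl⟩ := ih
    have hd : (u - v).natAbs = k ∨ (u - v).natAbs = t := h.2
    rw [SimpleGraph.Walk.length_cons]
    rcases hd with hd | hd <;> rcases Int.natAbs_eq (u - v) with he | he <;> rw [hd] at he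
    · exact ⟨a - 1, b, by linear_combination hab - he, by omega⟩
    · exact ⟨a + 1, b, by linear_combination hab - he, by omega⟩
    · exact ⟨a, b - 1, by linear_combination hab - he, by omega⟩
    · exact ⟨a, b + 1, by linear_combination hab - he, by omega⟩

/-- A packing coloring of the square lattice that is invariant under translation by `(t, -k)`
induces a packing coloring of the distance graph `D(k, t)`. -/
lemma packingChromaticNumber_distanceGraph_le {k t p : ℕ} (ht : 0 < t) (hkt : k.Coprime t)
    (C : ℤ → ℤ → ℕ) (hper : ∀ x y, C (x + t) (y - k) = C x y)
    (hrange : ∀ x y, 1 ≤ C x y ∧ C x y ≤ p)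
    (hsep : ∀ x y x' y', (x, y) ≠ (x', y') → C x y = C x' y' →
      C x y < (x' - x).natAbs + (y' - y).natAbs) :
    packingChromaticNumber (distanceGraph {k, t}) ≤ p := by
  obtain ⟨u, v, huv⟩ : ∃ u v : ℤ, u * k + v * t = 1 :=
    Int.isCoprime_iff_gcd_eq_one.mpr (by simpa using hkt)
  have hper' : ∀ (z x y : ℤ), C (x + z * t) (y - z * k) = C x y := by
    intro z
    induction z with
    | zero => intro x y; simp
    | succ i ih =>
      intro x y
      rw [← ih x y, ← hper (x + i * t) (y - i * k)]
      congr 1 <;> ring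
    | pred i ih =>
      intro x y
      rw [← ih x y, ← hper (x + (-i - 1) * t) (y - (-i - 1) * k)]
      congr 1 <;> ring
  -- Any two lattice points representing the same integer differ by a multiple of `(t, -k)`.
  have hC : ∀ n m a b : ℤ, m - n = a * k + b * t →
      C (m * u) (m * v) = C (n * u + a) (n * v + b) := by
    intro n m a b h
    have h0 : (m * u - n * u - a) * k = -((m * v - n * v - b) * t) := by
      linear_combination (m - n) * huv + h
    have hdvd : (t : ℤ) ∣ m * u - n * u - a := by
      have : (t : ℤ) ∣ (m * u - n * u - a) * k := h0 ▸ (Dvd.intro_left _ rfl).neg_right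
      exact IsCoprime.dvd_of_dvd_mul_right
        (Nat.isCoprime_iff_coprime.mpr hkt.symm) this
    obtain ⟨z, hz⟩ := hdvd
    have ht' : (t : ℤ) ≠ 0 := by exact_mod_cast ht.ne'
    have hy : m * v - n * v - b = -(z * k) := by
      apply mul_right_cancel₀ ht'
      rw [hz] at h0
      linear_combination h0
    rw [← hper' z (n * u + a) (n * v + b)]
    congr 1 <;> linarith
  refine iInf₂_le p ⟨fun n => C (n * u) (n * v), fun n => hrange _ _, fun n m hnm hc => ?_⟩
  by_contra hlt
  rw [not_lt] at hlt
  obtain ⟨w, hw⟩ := SimpleGraph.exists_walk_of_edist_ne_top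
    (ne_top_of_le_ne_top (ENat.natCast_ne_top _) hlt)
  rw [← hw, Nat.cast_le] at hlt
  obtain ⟨a, b, hab, hl⟩ := exists_combination_of_walk w
  have h := hC n m a b hab
  have hne : (n * u, n * v) ≠ (n * u + a, n * v + b) := by
    intro he
    simp only [Prod.mk.injEq, left_eq_add] at he
    apply hnm
    rw [he.1, he.2] at hab
    linarith
  have := hsep _ _ _ _ hne (hc.trans h)
  simp only [add_sub_cancel_left] at this
  change w.length ≤ C (n * u) (n * v) at hlt
  omega

/-- It is enough to color the strip `0 ≤ x < t`, keeping equal colors apart inside the strip and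
across its boundary. -/
lemma packingChromaticNumber_distanceGraph_le_of_strip {k t p : ℕ} (hpt : p < t)
    (hkt : k.Coprime t) (C : ℤ → ℤ → ℕ) (hrange : ∀ x y, 1 ≤ C x y ∧ C x y ≤ p)
    (hin : ∀ x y x' y' : ℤ, 0 ≤ x → x ≤ x' → x' < t → (x, y) ≠ (x', y') → C x y = C x' y' →
      C x y < (x' - x).natAbs + (y' - y).natAbs)
    (hacross : ∀ x y x' y' : ℤ, x < t → 0 ≤ x' → x' + t - x ≤ p → C x y = C x' y' →
      C x y < (x' + t - x).natAbs + (y' - k - y).natAbs) :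
    packingChromaticNumber (distanceGraph {k, t}) ≤ p := by
  have ht : (0 : ℤ) < t := by omega
  refine packingChromaticNumber_distanceGraph_le (by omega) hkt
    (fun x y => C (x % t) (y + x / t * k)) (fun x y => ?_) (fun x y => hrange _ _) ?_
  · simp only [Int.add_emod_right, Int.add_ediv_of_dvd_right dvd_rfl, Int.ediv_self ht.ne']
    congr 1
    ring
  have main : ∀ x y x' y' : ℤ, x ≤ x' → (x, y) ≠ (x', y') →
      C (x % t) (y + x / t * k) = C (x' % t) (y' + x' / t * k) →
      C (x % t) (y + x / t * k) < (x' - x).natAbs + (y' - y).natAbs := by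
    intro x y x' y' hle hne hc
    by_contra hlt
    rw [not_lt] at hlt
    have hp := (hrange (x % t) (y + x / t * k)).2
    have h1 := Int.emod_add_mul_ediv x t
    have h2 := Int.emod_add_mul_ediv x' t
    have hx0 := Int.emod_nonneg x ht.ne'
    have hx0' := Int.emod_nonneg x' ht.ne'
    have hx1 := Int.emod_lt_of_pos x ht
    have hx1' := Int.emod_lt_of_pos x' ht
    generalize x % t = r at *
    generalize x' % t = r' at *
    generalize x / t = q at *
    generalize x' / t = q' at *
    have hq : q ≤ q' := by
      by_contra! h
      nlinarith
    -- Skipping a whole strip would cost more than `t > p` columns.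
    have hq' : q' ≤ q + 1 := by
      by_contra! h
      have : (t : ℤ) * (q + 2) ≤ t * q' := by gcongr; omega
      have : x' - x ≤ p := by omega
      have : (p : ℤ) < t := by exact_mod_cast hpt
      linarith
    rcases (by omega : q' = q ∨ q' = q + 1) with rfl | rfl
    · have := hin r (y + q' * k) r' (y' + q' * k) hx0 (by omega) hx1'
        (by
          intro h
          simp only [Prod.mk.injEq, add_left_inj] at h
          exact hne (by rw [Prod.mk.injEq]; exact ⟨by omega, h.2⟩)) hc
      rw [show r' - r = x' - x by omega, show y' + q' * k - (y + q' * k) = y' - y by ring] at this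
      omega
    · have hd : r' + t - r = x' - x := by linarith
      have := hacross r (y + q * k) r' (y' + (q + 1) * k) hx1 hx0' (by omega) hc
      rw [hd, show y' + (q + 1) * k - k - (y + q * k) = y' - y by ring] at this
      omega
  intro x y x' y' hne hc
  rcases le_total x x' with h | h
  · exact main x y x' y' h hne hc
  · have := main x' y' x y h hne.symm hc.symm
    have hc' : C (x % t) (y + x / t * k) = C (x' % t) (y' + x' / t * k) := hc
    change C (x % t) (y + x / t * k) < _
    omega

/-! ### Periodic words and a doubly periodic pattern -/

/-- The `i`-th digit of `N` in base `100`. -/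
def centesimalDigit (N i : ℕ) : ℕ := N / 100 ^ i % 100

/-- The bi-infinite word of period `P` whose letters are the last `P` base `100` digits of `N`. -/
def periodicWord (N P : ℕ) (y : ℤ) : ℕ := centesimalDigit N (y % P).toNat

lemma periodicWord_of_forall {N P : ℕ} (hP : 0 < P) {p : ℕ → Prop}
    (h : ∀ i < P, p (centesimalDigit N i)) (y : ℤ) : p (periodicWord N P y) :=
  h _ (by have := Int.emod_lt_of_pos y (b := P) (by omega); omega)

lemma gap_le_of_periodicWord_eq {N P : ℕ} (hP : 0 < P) {g : ℕ → ℕ}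
    (h : ∀ i < P, ∀ d < g (centesimalDigit N i), d ≠ 0 →
      centesimalDigit N ((i + d) % P) ≠ centesimalDigit N i)
    {y y' : ℤ} (hne : y ≠ y') (hw : periodicWord N P y = periodicWord N P y') :
    g (periodicWord N P y) ≤ (y' - y).natAbs := by
  have main : ∀ y y' : ℤ, y < y' → periodicWord N P y = periodicWord N P y' →
      g (periodicWord N P y) ≤ (y' - y).natAbs := by
    intro y y' hlt hw
    by_contra! hg
    have hy0 := Int.emod_nonneg y (b := P) (by omega)
    have hy1 := Int.emod_lt_of_pos y (b := P) (by omega)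
    refine h (y % P).toNat (by omega) _ hg (by omega) ?_
    rw [periodicWord, periodicWord] at hw
    rw [hw]
    congr 1
    zify
    rw [Int.toNat_of_nonneg hy0, Int.toNat_of_nonneg (Int.emod_nonneg _ (by omega)),
      abs_of_pos (by omega)]
    simp
  rcases lt_or_gt_of_ne hne with hlt | hlt
  · exact main y y' hlt hw
  · have := main y' y hlt hw.symm
    rw [hw]
    omega

/-- A word in the letters `19, …, 56` in which equal letters `c` are more than `c` apart. -/
def fullWord : ℤ → ℕ :=
  periodicWord 242037365630192242335429432627442335392555212031322428195047452251383441304852462623362729203733251940214924223128433532533942564423205426193430273821294522242536553341512846504820372331523219352640212722303924342925434944422038475333233619562128542245263127412437323046202529553534195139215023224052332843384224272620483644312547301929323721224553492334565435202446392627331941282540213855224330423129362320515052193224374426342148272545223347353920282319305349463141562440212954384232222620273637341923552543284451352130502433484539202947225226192731234140324625382128344953 288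

/-- A word in letters among `19, …, 56` in which equal letters `c` are more than `c / 2` apart. -/
def evenWord : ℤ → ℕ :=
  periodicWord 472131522844225034294554214056533035462242284931292147553444522230504045283521293154424622563449305321284447294022353145502152553042284622342954214931354447535622304021282945504234314622522155353049544447284029223121535634454230503546282229215231445549405434302221283529534547423156502221463034442852492940352122315455454247533028213429225056354640443152214930222845423454294721553553223140502844302146293449524522425631214728355430402922533421445055314628494522352129305242405647343154212244532829355030454621552231403449422852472129352244543056533145212834404622294255493530 288

/-- A word like `evenWord`, in the letters among `19, …, 56` that `evenWord` does not use. -/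
def oddWord : ℤ → ℕ :=
  periodicWord 362637205127193225432438412320263339194827253736322023241926513843332725203919232432412648363720252733192324433851393226202519272341372436334820192625323823394324271951203733252623364119322420382739482523194333372620243651321927412325382039263319244837432736203223251926415138332439202719372325324336264824192033412327253938511937322420362643232719332548412024393832262319273651252033243743192326413227382039482519243323 210

lemma fullWord_range (y : ℤ) : 19 ≤ fullWord y ∧ fullWord y ≤ 56 :=
  periodicWord_of_forall (p := fun c => 19 ≤ c ∧ c ≤ 56) (by norm_num) (by decide +kernel) y

lemma evenWord_range (y : ℤ) : 19 ≤ evenWord y ∧ evenWord y ≤ 56 :=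
  periodicWord_of_forall (p := fun c => 19 ≤ c ∧ c ≤ 56) (by norm_num) (by decide +kernel) y

lemma oddWord_range (y : ℤ) : 19 ≤ oddWord y ∧ oddWord y ≤ 56 :=
  periodicWord_of_forall (p := fun c => 19 ≤ c ∧ c ≤ 56) (by norm_num) (by decide +kernel) y

lemma evenWord_ne_oddWord (y y' : ℤ) : evenWord y ≠ oddWord y' := by
  intro h
  have h1 : oddWord y' ∈ [19, 20, 23, 24, 25, 26, 27, 32, 33, 36, 37, 38, 39, 41, 43, 48, 51] :=
    periodicWord_of_forall (p := fun c => c ∈ _) (by norm_num) (by decide +kernel) y'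
  have h2 : evenWord y ∉ [19, 20, 23, 24, 25, 26, 27, 32, 33, 36, 37, 38, 39, 41, 43, 48, 51] :=
    periodicWord_of_forall (p := fun c => c ∉ _) (by norm_num) (by decide +kernel) y
  exact h2 (h ▸ h1)

lemma fullWord_gap {y y' : ℤ} (hne : y ≠ y') (hw : fullWord y = fullWord y') :
    fullWord y + 1 ≤ (y' - y).natAbs :=
  gap_le_of_periodicWord_eq (g := fun c => c + 1) (by norm_num) (by decide +kernel) hne hw

lemma evenWord_gap {y y' : ℤ} (hne : y ≠ y') (hw : evenWord y = evenWord y') :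
    evenWord y / 2 + 1 ≤ (y' - y).natAbs :=
  gap_le_of_periodicWord_eq (g := fun c => c / 2 + 1) (by norm_num) (by decide +kernel) hne hw

lemma oddWord_gap {y y' : ℤ} (hne : y ≠ y') (hw : oddWord y = oddWord y') :
    oddWord y / 2 + 1 ≤ (y' - y).natAbs :=
  gap_le_of_periodicWord_eq (g := fun c => c / 2 + 1) (by norm_num) (by decide +kernel) hne hw

/-- The colors of `ℤ / 4 × ℤ / 64`. -/
def torusColor (a w : ℕ) : ℕ :=
  centesimalDigit 3080307030503140304030703130305030903070304030903050307031303040308030703050314030403070313030503160307030403140305030703110304080205021002060204021002050206021002040217020602050218020402060208020502120206020402110205020602110204020902060205020902040206020308030703040315030503070312030403090307030503150304030703110305030803070304031503050307031203040316030703050315030403070312030508020402130206020502110204020602110205021702060204021802050206020802040210020602050210020402060210020502090206020402090205020602 (64 * (a % 4) + w % 64)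

lemma torusColor_range : ∀ a < 4, ∀ w < 64, 2 ≤ torusColor a w ∧ torusColor a w ≤ 18 := by
  decide +kernel

-- `e` encodes the vertical offset `e - c / 2`, where `c` is the color. Passing from `v` to `v - 6 *
-- u` subtracts `6 * d`. Adding 64 avoids truncation, as `c / 2 + 6 * d ≤ 9 + 54`.
set_option synthInstance.maxSize 1000 in
lemma torusColor_ne : ∀ a < 4, ∀ w < 64, ∀ d < torusColor a w / 2 + 1,
    ∀ e < 2 * (torusColor a w / 2) + 1, d = 0 ∧ e = torusColor a w / 2 ∨
      torusColor (a + d) (w + e + (64 - torusColor a w / 2 - 6 * d)) ≠ torusColor a w := by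
  decide +kernel

/-- A coloring of the plane with period lattice generated by `(4, 24)` and `(0, 64)`, in which equal
colors `c` are more than `c / 2` apart in the supremum distance. -/
def planeColor (u v : ℤ) : ℕ := torusColor (u % 4).toNat ((v - 6 * u) % 64).toNat

lemma planeColor_range (u v : ℤ) : 2 ≤ planeColor u v ∧ planeColor u v ≤ 18 :=
  torusColor_range _ (by omega) _ (by omega)

lemma planeColor_add {p q : ℤ} (hp : p % 4 = 0) (hq : (q - 6 * p) % 64 = 0) (u v : ℤ) :
    planeColor (u + p) (v + q) = planeColor u v := by
  unfold planeColor
  congr 2 <;> omega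

lemma torusColor_congr {a a' w w' : ℕ} (ha : a % 4 = a' % 4) (hw : w % 64 = w' % 64) :
    torusColor a w = torusColor a' w' := by
  rw [torusColor, torusColor, ha, hw]

lemma planeColor_sep {u v u' v' : ℤ} (hne : u ≠ u' ∨ v ≠ v')
    (hc : planeColor u v = planeColor u' v') :
    planeColor u v / 2 < max (u' - u).natAbs (v' - v).natAbs := by
  have main : ∀ u v u' v' : ℤ, u ≤ u' → (u ≠ u' ∨ v ≠ v') → planeColor u v = planeColor u' v' →
      planeColor u v / 2 < max (u' - u).natAbs (v' - v).natAbs := by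
    intro u v u' v' hle hne hc
    by_contra! hlt
    have hr := planeColor_range u v
    have key := torusColor_ne (u % 4).toNat (by omega) ((v - 6 * u) % 64).toNat (by omega)
      (u' - u).toNat
    change _ < planeColor u v / 2 + 1 → ∀ e < 2 * (planeColor u v / 2) + 1, (_ ∧ e = planeColor u v / 2) ∨
      torusColor _ (_ + e + (64 - planeColor u v / 2 - _)) ≠ planeColor u v at key
    refine (key (by omega) (v' - v + (planeColor u v / 2 : ℕ)).toNat (by omega)).resolve_left
      (by omega) ?_
    rw [hc]
    exact torusColor_congr (by omega) (by omega)
  rcases le_total u u' with h | h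
  · exact main u v u' v' h hne hc
  · have := main u' v' u v h (by omega) hc.symm
    omega

lemma exists_steps_small : ∀ a < 4, ∀ b < 64, ∃ i < 29, ∃ j < 29 - i,
    i % 4 = a ∧ (j + 192 - 6 * i) % 64 = b := by
  decide +kernel

/-- `i` and `j` will count the upward and downward seams. The bound 28 is the source of `898 = 29 *
28 + 86`. -/
lemma exists_steps (p q : ℤ) : ∃ i j : ℕ, i + j ≤ 28 ∧ (p - i) % 4 = 0 ∧
    (q - j - 6 * (p - i)) % 64 = 0 := by
  obtain ⟨i, hi, j, hj, h1, h2⟩ := exists_steps_small (p % 4).toNat (by omega)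
    ((q - 6 * p) % 64).toNat (by omega)
  exact ⟨i, j, by omega, by omega, by omega⟩

/-! ### The coloring of the strip -/

/-- The number of seams in the columns `≤ x`, if the `n` seams are the columns `57, 86, 115, …`. -/
def seamCount (n : ℕ) (x : ℤ) : ℤ := max 0 (min n ((x - 28) / 29))

/-- The vertical displacement of column `x`, if the first `m` seams shift the pattern upwards and the
others downwards. -/
def seamShift (n m : ℕ) (x : ℤ) : ℤ := min (seamCount n x) (2 * m - seamCount n x)

lemma seamCount_sub (n : ℕ) {x x' : ℤ} (h : x ≤ x') :
    0 ≤ seamCount n x' - seamCount n x ∧ seamCount n x' - seamCount n x ≤ x' - x := by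
  unfold seamCount
  omega

lemma natAbs_seamShift_sub (n m : ℕ) {x x' : ℤ} (h : x ≤ x') :
    ((seamShift n m x' - seamShift n m x).natAbs : ℤ) ≤ seamCount n x' - seamCount n x := by
  have := seamCount_sub n h
  unfold seamShift
  omega

/-- Undoing the seams therefore preserves the parity of the coordinate sum. -/
lemma even_seamCount_add_seamShift (n m : ℕ) (x : ℤ) :
    (seamCount n x + seamShift n m x) % 2 = 0 := by
  unfold seamShift
  omega

lemma eq_of_seamCount_lt {n : ℕ} {x : ℤ} (h : seamCount n (x - 1) < seamCount n x) :
    x = 28 + 29 * seamCount n x ∧ 1 ≤ seamCount n x := by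
  unfold seamCount at *
  omega

lemma seamCount_of_lt {n : ℕ} {x : ℤ} (h : x < 57) : seamCount n x = 0 := by
  unfold seamCount
  omega

lemma seamCount_of_le {n : ℕ} {x : ℤ} (h : 28 + 29 * (n : ℤ) ≤ x) : seamCount n x = n := by
  unfold seamCount
  omega

/-- The planar pattern in the points with odd coordinate sum. -/
def bulkColor (n m : ℕ) (x y : ℤ) : ℕ :=
  planeColor ((x - seamCount n x + (y - seamShift n m x) - 1) / 2)
    ((x - seamCount n x - (y - seamShift n m x) - 1) / 2)

/-- The coloring of the strip: column `0` carries colors above `18` only, the seams alternate between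
two disjoint sets of such colors, and all other columns are colored by the planar pattern. -/
def stripColor (n m : ℕ) (x y : ℤ) : ℕ :=
  if x = 0 then fullWord y
  else if (x + y) % 2 = 0 then 1
  else if seamCount n (x - 1) < seamCount n x then
    if seamCount n x % 2 = 0 then evenWord (y / 2) else oddWord (y / 2)
  else bulkColor n m x y

/-! ### Verification of the strip coloring -/

lemma bulkColor_range (n m : ℕ) (x y : ℤ) : 2 ≤ bulkColor n m x y ∧ bulkColor n m x y ≤ 18 :=
  planeColor_range _ _

lemma stripColor_range (n m : ℕ) (x y : ℤ) : 1 ≤ stripColor n m x y ∧ stripColor n m x y ≤ 56 := by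
  have h1 := fullWord_range y
  have h2 := evenWord_range (y / 2)
  have h3 := oddWord_range (y / 2)
  have h4 := bulkColor_range n m x y
  unfold stripColor
  split_ifs <;> omega

/-- The rotation turns `ℓ¹` distance into twice the supremum distance, and `2 * (c / 2 + 1) > c`. -/
lemma planeColor_sep_rotated {X Y X' Y' : ℤ} (h : (X + Y) % 2 = 1) (h' : (X' + Y') % 2 = 1)
    (hne : X ≠ X' ∨ Y ≠ Y')
    (hc : planeColor ((X + Y - 1) / 2) ((X - Y - 1) / 2) =
      planeColor ((X' + Y' - 1) / 2) ((X' - Y' - 1) / 2)) :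
    planeColor ((X + Y - 1) / 2) ((X - Y - 1) / 2) < (X' - X).natAbs + (Y' - Y).natAbs := by
  have := planeColor_sep (by omega) hc
  omega

lemma stripColor_sep_inside {n m : ℕ} {x y x' y' : ℤ} (h0 : 0 ≤ x) (hle : x ≤ x')
    (hne : (x, y) ≠ (x', y')) (hc : stripColor n m x y = stripColor n m x' y') :
    stripColor n m x y < (x' - x).natAbs + (y' - y).natAbs := by
  have hne' : x ≠ x' ∨ y ≠ y' := by
    by_contra! h
    exact hne (by rw [h.1, h.2])
  have f1 := fullWord_range y
  have f2 := evenWord_range (y / 2)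
  have f3 := oddWord_range (y / 2)
  have f4 := bulkColor_range n m x y
  have f1' := fullWord_range y'
  have f2' := evenWord_range (y' / 2)
  have f3' := oddWord_range (y' / 2)
  have f4' := bulkColor_range n m x' y'
  unfold stripColor at hc ⊢
  by_cases hx : x = 0
  · by_cases hx' : x' = 0
    · simp only [hx, hx', if_true] at hc ⊢
      have := fullWord_gap (by omega) hc
      omega
    · simp only [hx, hx', if_true, if_false] at hc ⊢
      by_cases hs' : seamCount n (x' - 1) < seamCount n x'
      -- The first seam is column 57, out of reach of column `0` for colors up to 56.
      · have := eq_of_seamCount_lt hs'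
        omega
      · simp only [hs', if_false] at hc
        split_ifs at hc <;> omega
  have hx' : x' ≠ 0 := by omega
  simp only [hx, hx', if_false] at hc ⊢
  by_cases hp : (x + y) % 2 = 0
  · by_cases hp' : (x' + y') % 2 = 0
    · simp only [hp, if_true]
      omega
    · simp only [hp, hp', if_true, if_false] at hc
      split_ifs at hc <;> omega
  by_cases hp' : (x' + y') % 2 = 0
  · simp only [hp, hp', if_true, if_false] at hc
    split_ifs at hc <;> omega
  simp only [hp, hp', if_false] at hc ⊢
  by_cases hs : seamCount n (x - 1) < seamCount n x
  · by_cases hs' : seamCount n (x' - 1) < seamCount n x'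
    · simp only [hs, hs', if_true] at hc ⊢
      have e := eq_of_seamCount_lt hs
      have e' := eq_of_seamCount_lt hs'
      by_cases hxx : x = x'
      · subst hxx
        split_ifs at hc ⊢
        · have := evenWord_gap (by omega) hc
          omega
        · have := oddWord_gap (by omega) hc
          omega
      -- Distinct seams using the same word are at least 58 columns apart.
      · by_cases hm : seamCount n x % 2 = seamCount n x' % 2
        · split_ifs at hc ⊢ <;> omega
        · split_ifs at hc ⊢ with h1 h2 h2
          · omega
          · exact absurd hc (evenWord_ne_oddWord _ _)
          · exact absurd hc.symm (evenWord_ne_oddWord _ _)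
          · omega
    · simp only [hs, hs', if_true, if_false] at hc
      split_ifs at hc <;> omega
  by_cases hs' : seamCount n (x' - 1) < seamCount n x'
  · simp only [hs, hs', if_true, if_false] at hc
    split_ifs at hc <;> omega
  simp only [hs, hs', if_false] at hc ⊢
  have d1 := seamCount_sub n hle
  have d2 := natAbs_seamShift_sub n m hle
  -- Column `x'` is not a seam, so distinct columns stay distinct once the seams are removed.
  have d3 : x < x' → seamCount n x' - seamCount n x ≤ x' - 1 - x := by
    intro hlt
    have := seamCount_sub n (show x ≤ x' - 1 by omega)
    omega
  have e1 := even_seamCount_add_seamShift n m x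
  have e2 := even_seamCount_add_seamShift n m x'
  unfold bulkColor at hc ⊢
  refine (planeColor_sep_rotated (by omega) (by omega) ?_ hc).trans_le (by omega)
  rcases hle.lt_or_eq with hlt | rfl
  · have := d3 hlt
    omega
  · omega

/-- Seen from the right end of the strip, the next strip continues the same pattern, with its column
`0` deleted: this is the `-1` in `p + q`. The period `(p, q)` absorbs the accumulated displacement,
and the margin 86 keeps seams away from the boundary on both sides. -/
lemma stripColor_sep_across {n m k t : ℕ} (hnt : 29 * n + 86 ≤ t) (hmn : m ≤ n)
    (hk : k % 2 = 1) (ht : t % 2 = 0)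
    {p q : ℤ} (hp : p % 4 = 0) (hq : (q - 6 * p) % 64 = 0)
    (hpq : p + q = t - 1 - n) (hpq' : p - q = n - 2 * m - k)
    {x y x' y' : ℤ} (hx : x < t) (hx' : 0 ≤ x') (hle : x' + t - x ≤ 56)
    (hc : stripColor n m x y = stripColor n m x' y') :
    stripColor n m x y < (x' + t - x).natAbs + (y' - k - y).natAbs := by
  have f4 := bulkColor_range n m x y
  have f1' := fullWord_range y'
  have f4' := bulkColor_range n m x' y'
  have c1 : seamCount n x = n := seamCount_of_le (by omega)
  have c2 : seamCount n (x - 1) = n := seamCount_of_le (by omega)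
  have c1' : seamCount n x' = 0 := seamCount_of_lt (by omega)
  have c2' : seamCount n (x' - 1) = 0 := seamCount_of_lt (by omega)
  unfold stripColor at hc ⊢
  have hx0 : x ≠ 0 := by omega
  simp only [hx0, c1, c2, c1', c2', if_false, lt_irrefl] at hc ⊢
  by_cases hx0' : x' = 0
  · simp only [hx0', if_true] at hc
    split_ifs at hc <;> omega
  simp only [hx0', if_false] at hc
  -- Color 1 switches parity here, but column `0` lies strictly between the two points, so they are
  -- at least 2 columns apart.
  by_cases hpar : (x + y) % 2 = 0
  · simp only [hpar, if_true]
    omega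
  by_cases hpar' : (x' + y') % 2 = 0
  · simp only [hpar, hpar', if_true, if_false] at hc
    omega
  simp only [hpar, hpar', if_false] at hc ⊢
  have s1 : seamShift n m x = 2 * m - n := by
    unfold seamShift
    omega
  have s1' : seamShift n m x' = 0 := by
    unfold seamShift
    omega
  unfold bulkColor at hc ⊢
  rw [c1, s1] at hc ⊢
  rw [c1', s1', ← planeColor_add hp hq ((x' - 0 + (y' - 0) - 1) / 2),
    show (x' - 0 + (y' - 0) - 1) / 2 + p = (x' + p + q + (y' + p - q) - 1) / 2 by omega,
    show (x' - 0 - (y' - 0) - 1) / 2 + q = (x' + p + q - (y' + p - q) - 1) / 2 by omega] at hc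
  refine (planeColor_sep_rotated (by omega) (by omega) (by omega) hc).trans_le (by omega)

theorem theorem2 (k t : ℕ) (hk : Odd k) (ht : Even t) (ht898 : 898 ≤ t)
    (hkt : Nat.Coprime k t) :
    packingChromaticNumber (distanceGraph {k, t}) ≤ 56 := by
  rw [Nat.odd_iff] at hk
  rw [Nat.even_iff] at ht
  -- The translation `(t - 1, -k)` in rotated coordinates; `t - 1` and `k` are both odd.
  obtain ⟨i, j, hij, hp, hq⟩ := exists_steps (((t : ℤ) - 1 - k) / 2) (((t : ℤ) - 1 + k) / 2)
  have h := packingChromaticNumber_distanceGraph_le_of_strip (p := 56) (by omega) hkt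
    (stripColor (i + j) i) (stripColor_range _ _)
    (fun x y x' y' h0 hle _ hne hc => stripColor_sep_inside h0 hle hne hc)
    (fun x y x' y' hx hx' hle hc => stripColor_sep_across (by omega) (by omega) hk ht hp hq
      (by omega) (by omega) hx hx' hle hc)
  exact_mod_cast h
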